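/- Let $(\mathcal X,d)$ be a metric space and $\mu$ a regular Borel measure on $\mathcal X$ such that all balls $B(x,r)=\{y: d(x,y)<r\}$, $r\in(0,\infty)$, have positive and finite measure, and assume that $\mu$ is doubling: there exist constants $C_1>1$ and $n>0$ such that $\mu(B(x,\lambda r))\le C_1\lambda^n\mu(B(x,r))$ for all $x\in\mathcal X$, $r\in(0,\infty)$ and $\lambda\in(1,\infty)$. Let $s\in(0,\infty)$ and $p,q\in(0,\infty]$. The homogeneous Besov space $\dot B^s_{p,q}(\mathcal X)$ is the collection of all real-valued functions $u$ on $\mathcal X$ that belong to $L^p(B)$ for every ball $B$ and satisfy $$\|u\|_{\dot B^s_{p,q}(\mathcal X)}=\left(\int_0^\infty\left(\int_{\mathcal X}\frac1{\mu(B(x,t))}\int_{B(x,t)}|u(x)-u(y)|^p\,d\mu(y)\,d\mu(x)\right)^{q/p}\frac{dt}{t^{1+sq}}\right)^{1/q}<\infty,$$ where for $p=\infty$ the expression $\big(\int_{\mathcal X}\frac1{\mu(B(x,t))}\int_{B(x,t)}|u(x)-u(y)|^p\,d\mu(y)\,d\mu(x)\big)^{1/p}$ is replaced by $\operatorname{ess\,sup}_{x\in\mathcal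 X}\operatorname{ess\,sup}_{y\in B(x,t)}|u(x)-u(y)|$, and for $q=\infty$ the outer integral $\big(\int_0^\infty (\cdot)^q\,\frac{dt}{t^{1+sq}}\big)^{1/q}$ is replaced by $\sup_{t>0}t^{-s}(\cdot)$. For a measurable function $u:\mathcal X\to\mathbb R$, a sequence $\vec g=\{g_k\}_{k\in\mathbb Z}$ of nonnegative measurable functions on $\mathcal X$ is called a fractional $s$-Hajłasz gradient of $u$ if there exists $E\subset\mathcal X$ with $\mu(E)=0$ such that for all $k\in\mathbb Z$ and all $x,y\in\mathcal X\setminus E$ with $2^{-k-1}\le d(x,y)<2^{-k}$, $$|u(x)-u(y)|\le d(x,y)^s\,[g_k(x)+g_k(y)].$$ The homogeneous Hajłasz–Besov space $\dot N^s_{p,q}(\mathcal X)$ is the space of all measurable functions $u:\mathcal X\to\mathbb R$ such that $$\|u\|_{\dot N^s_{p,q}(\mathcal X)}=\inf_{\vec g}\left(\sum_{k\in\mathbb Z}\|g_k\|_{L^p(\mathcal X)}^q\right)^{1/q}<\infty,$$ where the infimum is over all fractional $s$-Hajłasz gradients $\vec g$ of $u$ and $\big(\sum_k(\cdot)^q\big)^{1/q}$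 is replaced by $\sup_k$ when $q=\infty$. Theorem. For all $s\in(0,\infty)$ and $p,q\in(0,\infty]$, $\dot N^s_{p,q}(\mathcal X)=\dot B^s_{p,q}(\mathcal X)$ as sets of functions, with equivalent (quasi-)seminorms: there is a constant $C$, independent of $u$, such that for every $u$ in this space $$\|u\|_{\dot B^s_{p,q}(\mathcal X)}\le C\|u\|_{\dot N^s_{p,q}(\mathcal X)}\quad\text{and}\quad \|u\|_{\dot N^s_{p,q}(\mathcal X)}\le C\|u\|_{\dot B^s_{p,q}(\mathcal X)}.$$ -/

import Mathlib

open MeasureTheory Set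
open scoped ENNReal NNReal

namespace MetricBesov

/-- `μ` is a doubling measure on the metric space `X`: all (open) balls have positive and finite
measure, and `μ(B(x, λr)) ≤ C₁ λⁿ μ(B(x, r))` for some constants `C₁ > 1`, `n > 0`. -/
structure IsDoubling {X : Type*} [MetricSpace X] [MeasurableSpace X] (μ : Measure X) : Prop where
  ball_pos : ∀ (x : X) (r : ℝ), 0 < r → 0 < μ (Metric.ball x r)
  ball_lt_top : ∀ (x : X) (r : ℝ), 0 < r → μ (Metric.ball x r) < ∞
  doubling : ∃ C₁ n : ℝ, 1 < C₁ ∧ 0 < n ∧ ∀ (x : X) (r l : ℝ), 0 < r → 1 < l →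
    μ (Metric.ball x (l * r)) ≤ ENNReal.ofReal (C₁ * l ^ n) * μ (Metric.ball x r)

section

variable {X : Type*} [MetricSpace X] [MeasurableSpace X]

/-- The `L^p`-averaged difference of `u` at scale `t`,
`(∫_X ⨍_{B(x,t)} |u(x) - u(y)|^p dμ(y) dμ(x))^{1/p}`; for `p = ∞` both averages are replaced by
essential suprema. -/
noncomputable def avgDiff (μ : Measure X) (p : ℝ≥0∞) (u : X → ℝ) (t : ℝ) : ℝ≥0∞ :=
  if p = ∞ then
    essSup (fun x => essSup (fun y => ‖u x - u y‖ₑ) (μ.restrict (Metric.ball x t))) μ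
  else
    (∫⁻ x, ⨍⁻ y in Metric.ball x t, ‖u x - u y‖ₑ ^ p.toReal ∂μ ∂μ) ^ (1 / p.toReal)

/-- The homogeneous Besov (quasi-)seminorm
`(∫_0^∞ (∫_X ⨍_{B(x,t)} |u(x) - u(y)|^p dμ(y) dμ(x))^{q/p} dt / t^{1+sq})^{1/q}`;
for `q = ∞` it is `sup_{t > 0} t^{-s} (avgDiff at scale t)`. -/
noncomputable def besovNorm (μ : Measure X) (s : ℝ) (p q : ℝ≥0∞) (u : X → ℝ) : ℝ≥0∞ :=
  if q = ∞ then
    ⨆ t ∈ Ioi (0 : ℝ), ENNReal.ofReal (t ^ (-s)) * avgDiff μ p u t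
  else
    (∫⁻ t in Ioi (0 : ℝ),
      avgDiff μ p u t ^ q.toReal / ENNReal.ofReal (t ^ (1 + s * q.toReal))) ^ (1 / q.toReal)

/-- The homogeneous Besov space: all `u` that are in `L^p(B)` for each ball `B` and have finite
Besov seminorm. -/
def besovSpace (μ : Measure X) (s : ℝ) (p q : ℝ≥0∞) : Set (X → ℝ) :=
  {u | (∀ (x : X) (r : ℝ), 0 < r → MemLp u p (μ.restrict (Metric.ball x r))) ∧
    besovNorm μ s p q u < ∞}

/-- `g = (g_k)_{k ∈ ℤ}` is a fractional `s`-Hajłasz gradient of `u`. -/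
def IsHajlaszGradient (μ : Measure X) (s : ℝ) (u : X → ℝ) (g : ℤ → X → ℝ) : Prop :=
  (∀ k, AEStronglyMeasurable (g k) μ) ∧ (∀ k x, 0 ≤ g k x) ∧
    ∃ E : Set X, μ E = 0 ∧ ∀ (k : ℤ) (x y : X), x ∉ E → y ∉ E →
      (2 : ℝ) ^ (-k - 1) ≤ dist x y → dist x y < (2 : ℝ) ^ (-k) →
        |u x - u y| ≤ dist x y ^ s * (g k x + g k y)

/-- The `ℓ^q(L^p(X))` (quasi-)norm of a sequence of functions indexed by `ℤ`. -/
noncomputable def lqLpNorm (μ : Measure X) (p q : ℝ≥0∞) (g : ℤ → X → ℝ) : ℝ≥0∞ :=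
  if q = ∞ then ⨆ k, eLpNorm (g k) p μ
  else (∑' k, eLpNorm (g k) p μ ^ q.toReal) ^ (1 / q.toReal)

/-- The homogeneous Hajłasz-Besov (quasi-)seminorm: the infimum of the `ℓ^q(L^p(X))` norms of all
fractional `s`-Hajłasz gradients of `u`. -/
noncomputable def hajlaszBesovNorm (μ : Measure X) (s : ℝ) (p q : ℝ≥0∞) (u : X → ℝ) : ℝ≥0∞ :=
  ⨅ (g : ℤ → X → ℝ) (_ : IsHajlaszGradient μ s u g), lqLpNorm μ p q g

/-- The homogeneous Hajłasz-Besov space: all measurable `u` with finite Hajłasz-Besov seminorm. -/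
def hajlaszBesovSpace (μ : Measure X) (s : ℝ) (p q : ℝ≥0∞) : Set (X → ℝ) :=
  {u | AEStronglyMeasurable u μ ∧ hajlaszBesovNorm μ s p q u < ∞}

end

end MetricBesov

namespace MetricBesov

/-! ### Measure-theoretic and topological consequences of doubling. -/

section

variable {X : Type*} [MetricSpace X] [MeasurableSpace X] {μ : Measure X}

/-! Both seminorms are compared scale by scale, at the radii `2 ^ m`.

Besov by Hajłasz: two distinct points at distance less than `2 ^ (-j)` lie in exactly one dyadic
annulus `k ≥ j`, so `|u x - u y| ≤ G_j x + G_j y`, where `G_j` is the supremum over `k ≥ j` of `2 ^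
(-k s) g_k`. Doubling and Tonelli bound the averaged difference at that scale by `‖G_j‖_p`
(`exists_avgDiff_le_eLpNorm`). Of the decay `2 ^ (-i s)` at `k = j + i`, one half pays for moving
the supremum outside the `L^p` norm and the other half for a Hardy inequality in `ℓ^q`. Since `s >
0` and suprema replace sums, all `p, q > 0` are treated alike.

Hajłasz by Besov: for `d(x, y) < t`, compare `u x` and `u y` through a third point `z` averaged over
`B(x, t)` (`exists_enorm_sub_rpow_le_setLAverage`). This gives `|u x - u y| ≤ H x + H y` with
`‖H‖_p` controlled by the averaged difference at scale `2t`. With `t = 2 ^ (-k)`, the function `2 ^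
((k + 1) s) H` serves as `g_k`.

The integral in `t` and the sum over scales are exchanged by `scaleNorm_le_eLpNorm_count` and
`exists_eLpNorm_count_le_scaleNorm`. -/

theorem IsDoubling.sigmaFinite (hμ : IsDoubling μ) : SigmaFinite μ := by
  rcases isEmpty_or_nonempty X with hX | ⟨⟨x₀⟩⟩
  · have : μ = 0 := Measure.eq_zero_of_isEmpty μ
    rw [this]; infer_instance
  · refine ⟨⟨⟨fun n => Metric.ball x₀ (n + 1), fun _ => trivial,
      fun n => hμ.ball_lt_top _ _ (by positivity), ?_⟩⟩⟩
    refine eq_univ_of_forall fun x => mem_iUnion.2 ?_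
    obtain ⟨n, hn⟩ := exists_nat_gt (dist x x₀)
    exact ⟨n, by rw [Metric.mem_ball]; linarith⟩

/-- A maximal `ε`-separated set is `ε`-dense, and the balls of radius `ε / 2` about its points are
disjoint with positive measure, so σ-finiteness makes it countable. Separability makes `{dist < t}`
measurable for the product σ-algebra, as Tonelli requires. -/
theorem IsDoubling.secondCountableTopology [BorelSpace X] (hμ : IsDoubling μ) :
    SecondCountableTopology X := by
  have := hμ.sigmaFinite
  refine Metric.secondCountable_of_almost_dense_set fun ε hε => ?_
  obtain ⟨S, hS⟩ := zorn_subset {A : Set X | A.Pairwise fun x y => ε ≤ dist x y} (by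
    intro c hc hchain
    refine ⟨⋃₀ c, ?_, fun s hs => subset_sUnion_of_mem hs⟩
    exact (pairwise_sUnion hchain.directedOn).2 fun a ha => hc ha)
  have hsep : S.Pairwise fun x y => ε ≤ dist x y := hS.prop
  refine ⟨S, ?_, fun x => ?_⟩
  · have hc := Measure.countable_meas_pos_of_disjoint_iUnion (μ := μ)
      (As := fun x : S => Metric.ball (x : X) (ε / 2))
      (fun x => Metric.isOpen_ball.measurableSet) (by
        intro x y hxy
        refine Metric.ball_disjoint_ball ?_
        have := hsep x.2 y.2 (fun h => hxy (Subtype.ext h))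
        linarith)
    have : {i : S | 0 < μ (Metric.ball (i : X) (ε / 2))} = univ :=
      eq_univ_of_forall fun i => hμ.ball_pos _ _ (by positivity)
    rw [this] at hc
    exact countable_coe_iff.1 (countable_univ_iff.1 hc)
  · by_contra! hx
    have hins : insert x S ∈ {A : Set X | A.Pairwise fun x y => ε ≤ dist x y} := by
      refine hsep.insert fun y hy _ => ⟨(hx y hy).le, ?_⟩
      rw [dist_comm]; exact (hx y hy).le
    have hxS : x ∈ S := hS.le_of_ge hins (subset_insert _ _) (mem_insert _ _)
    have := hx x hxS
    rw [dist_self] at this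
    linarith

theorem IsDoubling.exists_measure_ball_two_mul_le (hμ : IsDoubling μ) :
    ∃ D : ℝ≥0, 1 ≤ D ∧ ∀ (x : X) (r : ℝ), 0 < r →
      μ (Metric.ball x (2 * r)) ≤ D * μ (Metric.ball x r) := by
  obtain ⟨C, n, hC, hn, h⟩ := hμ.doubling
  refine ⟨(C * 2 ^ n).toNNReal, ?_, fun x r hr => h x r 2 hr one_lt_two⟩
  rw [← Real.toNNReal_one]
  refine Real.toNNReal_le_toNNReal ?_
  nlinarith [Real.one_le_rpow one_le_two hn.le]

end

/-! ### Power inequalities, weighted suprema and averages. -/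

section

variable {α : Type*} [MeasurableSpace α] {μ : Measure α}

theorem ennreal_add_rpow_le {r : ℝ} (hr : 0 ≤ r) (a b : ℝ≥0∞) :
    (a + b) ^ r ≤ 2 ^ r * (a ^ r + b ^ r) := by
  calc (a + b) ^ r ≤ (2 * max a b) ^ r := by
        refine ENNReal.rpow_le_rpow ?_ hr
        rw [two_mul]; exact add_le_add (le_max_left _ _) (le_max_right _ _)
    _ = 2 ^ r * (max a b) ^ r := ENNReal.mul_rpow_of_nonneg _ _ hr
    _ ≤ _ := by
        gcongr
        rcases max_choice a b with h | h <;> rw [h]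
        exacts [le_self_add, le_add_self]

theorem iSup_rpow_le_tsum {ι : Type*} {r : ℝ} (hr : 0 < r) (f : ι → ℝ≥0∞) :
    (⨆ i, f i) ^ r ≤ ∑' i, f i ^ r := by
  have : (⨆ i, f i) ^ r = ⨆ i, f i ^ r :=
    (ENNReal.orderIsoRpow r hr).map_iSup f
  rw [this]
  exact iSup_le fun i => ENNReal.le_tsum i

theorem tsum_pow_rpow_lt_top {ρ : ℝ≥0∞} (hρ : ρ < 1) {r : ℝ} (hr : 0 < r) :
    ∑' i : ℕ, (ρ ^ i) ^ r < ∞ := by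
  have h : ∀ i : ℕ, (ρ ^ i) ^ r = (ρ ^ r) ^ i := fun i => by
    rw [← ENNReal.rpow_natCast, ← ENNReal.rpow_natCast, ← ENNReal.rpow_mul, ← ENNReal.rpow_mul,
      mul_comm]
  simp_rw [h, ENNReal.tsum_geometric]
  rw [ENNReal.inv_lt_top, tsub_pos_iff_lt]
  exact ENNReal.rpow_lt_one hρ hr

/-- For finite `p`, the `p`-th power of a supremum is at most the sum of the `p`-th powers, and the
weights `ρ ^ (i p)` are summable. No triangle inequality enters, so `p < 1` is allowed. It is
applied both to `μ` and to the counting measure on `ℤ`. -/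
theorem exists_eLpNorm_iSup_pow_mul_le (μ : Measure α) {p : ℝ≥0∞} (hp : 0 < p) {ρ : ℝ≥0∞}
    (hρ : ρ < 1) :
    ∃ C : ℝ≥0, ∀ f : ℕ → α → ℝ≥0∞, (∀ i, AEMeasurable (f i) μ) →
      eLpNorm (fun x => ⨆ i, ρ ^ i * f i x) p μ ≤ C * ⨆ i, eLpNorm (f i) p μ := by
  rcases eq_or_ne p ∞ with rfl | hp'
  · refine ⟨1, fun f _ => ?_⟩
    rw [ENNReal.coe_one, one_mul, eLpNorm_exponent_top]
    refine essSup_le_of_ae_le _ ?_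
    have h : ∀ᵐ x ∂μ, ∀ i, ‖f i x‖ₑ ≤ eLpNorm (f i) ∞ μ :=
      ae_all_iff.2 fun i => by
        rw [eLpNorm_exponent_top]; exact enorm_ae_le_eLpNormEssSup _ _
    filter_upwards [h] with x hx
    simp only [enorm_eq_self] at hx ⊢
    exact iSup_mono fun i => (mul_le_of_le_one_left' (pow_le_one' hρ.le i)).trans (hx i)
  · have hr : 0 < p.toReal := ENNReal.toReal_pos hp.ne' hp'
    have hT := tsum_pow_rpow_lt_top hρ hr
    have hT' : (∑' i : ℕ, (ρ ^ i) ^ p.toReal) ^ (1 / p.toReal) ≠ ∞ :=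
      (ENNReal.rpow_lt_top_of_nonneg (by positivity) hT.ne).ne
    refine ⟨((∑' i : ℕ, (ρ ^ i) ^ p.toReal) ^ (1 / p.toReal)).toNNReal, fun f hf => ?_⟩
    rw [ENNReal.coe_toNNReal hT', eLpNorm_eq_lintegral_rpow_enorm_toReal hp.ne' hp']
    set S := ⨆ i, eLpNorm (f i) p μ
    have hS : ∀ i, ∫⁻ x, f i x ^ p.toReal ∂μ ≤ S ^ p.toReal := fun i => by
      have h1 : eLpNorm (f i) p μ ≤ S := le_iSup (fun i => eLpNorm (f i) p μ) i
      have h2 := ENNReal.rpow_le_rpow h1 hr.le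
      rwa [eLpNorm_eq_lintegral_rpow_enorm_toReal hp.ne' hp', ← ENNReal.rpow_mul,
        one_div_mul_cancel hr.ne', ENNReal.rpow_one] at h2
    calc (∫⁻ x, ‖⨆ i, ρ ^ i * f i x‖ₑ ^ p.toReal ∂μ) ^ (1 / p.toReal)
        ≤ (∫⁻ x, ∑' i, (ρ ^ i) ^ p.toReal * f i x ^ p.toReal ∂μ) ^ (1 / p.toReal) := by
          gcongr with x
          rw [enorm_eq_self]
          refine (iSup_rpow_le_tsum hr _).trans_eq ?_
          simp_rw [ENNReal.mul_rpow_of_nonneg _ _ hr.le]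
      _ = (∑' i, (ρ ^ i) ^ p.toReal * ∫⁻ x, f i x ^ p.toReal ∂μ) ^ (1 / p.toReal) := by
          rw [lintegral_tsum fun i => ((hf i).pow_const _).const_mul _]
          congr 1
          exact tsum_congr fun i => lintegral_const_mul'' _ ((hf i).pow_const _)
      _ ≤ (∑' i, (ρ ^ i) ^ p.toReal * S ^ p.toReal) ^ (1 / p.toReal) := by
          gcongr with i
          exact hS i
      _ = _ := by
          rw [ENNReal.tsum_mul_right, ENNReal.mul_rpow_of_nonneg _ _ (by positivity),
            ← ENNReal.rpow_mul, mul_one_div_cancel hr.ne', ENNReal.rpow_one]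

theorem setLAverage_le_mul_setLAverage {s t : Set α} (hst : s ⊆ t) (hs : μ s ≠ 0)
    (ht : μ t ≠ ∞) {D : ℝ≥0} (hD : μ t ≤ D * μ s) (f : α → ℝ≥0∞) :
    ⨍⁻ x in s, f x ∂μ ≤ D * ⨍⁻ x in t, f x ∂μ := by
  have hs' : μ s ≠ ∞ := ((measure_mono hst).trans_lt ht.lt_top).ne
  have ht' : μ t ≠ 0 := fun h => hs (measure_mono_null hst h)
  rw [setLAverage_eq, setLAverage_eq, ENNReal.div_le_iff hs hs', mul_comm (D : ℝ≥0∞), mul_assoc]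
  calc ∫⁻ x in s, f x ∂μ ≤ ∫⁻ x in t, f x ∂μ := lintegral_mono_set hst
    _ = (∫⁻ x in t, f x ∂μ) / μ t * μ t := (ENNReal.div_mul_cancel ht' ht).symm
    _ ≤ _ := by gcongr

end

/-! ### Averages over balls and averaged differences. -/

section

variable {X : Type*} [MetricSpace X] [MeasurableSpace X] [BorelSpace X]

theorem measurable_measure_ball [SecondCountableTopology X] (μ : Measure X) [SFinite μ] (t : ℝ) :
    Measurable fun x => μ (Metric.ball x t) := by
  have h : MeasurableSet {z : X × X | dist z.2 z.1 < t} :=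
    (isOpen_lt (continuous_snd.dist continuous_fst) continuous_const).measurableSet
  exact measurable_measure_prodMk_left h

theorem aemeasurable_setLIntegral_ball [SecondCountableTopology X] (μ : Measure X) [SFinite μ]
    (t : ℝ) {F : X → X → ℝ≥0∞} (hF : AEMeasurable (Function.uncurry F) (μ.prod μ)) :
    AEMeasurable (fun x => ∫⁻ y in Metric.ball x t, F x y ∂μ) μ := by
  have h : MeasurableSet {z : X × X | dist z.2 z.1 < t} :=
    (isOpen_lt (continuous_snd.dist continuous_fst) continuous_const).measurableSet
  refine (hF.indicator h).lintegral_prod_right'.congr (ae_of_all _ fun x => ?_)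
  dsimp only
  rw [← lintegral_indicator Metric.isOpen_ball.measurableSet]
  rfl

/-- Swap the integrals: if `d(x, y) < t` then `B(y, t) ⊆ B(x, 2t)`, so `1 / μ(B(x, t)) ≤ D / μ(B(y,
t))`, and integrating this bound over `x ∈ B(y, t)` leaves the factor `D`. -/
theorem lintegral_setLAverage_ball_le {μ : Measure X} (hμ : IsDoubling μ) {D : ℝ≥0}
    (hD : ∀ (x : X) (r : ℝ), 0 < r → μ (Metric.ball x (2 * r)) ≤ D * μ (Metric.ball x r))
    {t : ℝ} (ht : 0 < t) {F : X → ℝ≥0∞} (hF : AEMeasurable F μ) :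
    ∫⁻ x, ⨍⁻ y in Metric.ball x t, F y ∂μ ∂μ ≤ D * ∫⁻ x, F x ∂μ := by
  have := hμ.sigmaFinite
  have := hμ.secondCountableTopology
  have hset : MeasurableSet {z : X × X | dist z.2 z.1 < t} :=
    (isOpen_lt (continuous_snd.dist continuous_fst) continuous_const).measurableSet
  let K : X × X → ℝ≥0∞ := {z : X × X | dist z.2 z.1 < t}.indicator
    fun z => (μ (Metric.ball z.1 t))⁻¹ * F z.2
  have hK : AEMeasurable K (μ.prod μ) :=
    ((((measurable_measure_ball μ t).inv.comp measurable_fst).aemeasurable).mul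
      hF.comp_snd).indicator hset
  have hball : ∀ x y : X, dist y x < t →
      (μ (Metric.ball x t))⁻¹ ≤ D * (μ (Metric.ball y t))⁻¹ := fun x y hxy => by
    have h1 : μ (Metric.ball y t) ≤ D * μ (Metric.ball x t) :=
      (measure_mono (Metric.ball_subset_ball' (by linarith))).trans (hD x t ht)
    have h0 := (hμ.ball_pos x t ht).ne'
    have h2 := (hμ.ball_lt_top x t ht).ne
    have h0' := (hμ.ball_pos y t ht).ne'
    have h2' := (hμ.ball_lt_top y t ht).ne
    rw [← div_eq_mul_inv, ENNReal.le_div_iff_mul_le (Or.inl h0') (Or.inl h2'), mul_comm,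
      ← div_eq_mul_inv]
    exact ENNReal.div_le_of_le_mul h1
  calc ∫⁻ x, ⨍⁻ y in Metric.ball x t, F y ∂μ ∂μ = ∫⁻ x, ∫⁻ y, K (x, y) ∂μ ∂μ := by
        refine lintegral_congr fun x => ?_
        rw [setLAverage_eq, div_eq_mul_inv, mul_comm, ← lintegral_const_mul'
          _ _ (ENNReal.inv_ne_top.2 (hμ.ball_pos x t ht).ne'),
          ← lintegral_indicator Metric.isOpen_ball.measurableSet]
        rfl
    _ = ∫⁻ y, ∫⁻ x, K (x, y) ∂μ ∂μ := lintegral_lintegral_swap hK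
    _ ≤ ∫⁻ y, ∫⁻ x in Metric.ball y t, D * (μ (Metric.ball y t))⁻¹ * F y ∂μ ∂μ := by
        refine lintegral_mono fun y => ?_
        dsimp only
        rw [← lintegral_indicator Metric.isOpen_ball.measurableSet]
        refine lintegral_mono fun x => ?_
        by_cases h : dist y x < t
        · have h' : x ∈ Metric.ball y t := by rwa [Metric.mem_ball, dist_comm]
          have h'' : (x, y) ∈ {z : X × X | dist z.2 z.1 < t} := h
          rw [indicator_of_mem h']
          simp only [K]
          rw [indicator_of_mem h'']
          gcongr
          exact hball x y h
        · have h'' : (x, y) ∉ {z : X × X | dist z.2 z.1 < t} := h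
          simp only [K]
          rw [indicator_of_notMem h'']
          exact zero_le
    _ = ∫⁻ y, D * F y ∂μ := by
        refine lintegral_congr fun y => ?_
        rw [setLIntegral_const, mul_right_comm, mul_assoc (D : ℝ≥0∞),
          ENNReal.inv_mul_cancel (hμ.ball_pos y t ht).ne' (hμ.ball_lt_top y t ht).ne, mul_one]
    _ = D * ∫⁻ x, F x ∂μ := lintegral_const_mul' _ _ ENNReal.coe_ne_top

/-- For finite `p`, averaging over `y` leaves `G x ^ p` unchanged, while the average of `G y ^ p` is
absorbed by `lintegral_setLAverage_ball_le`. -/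
theorem exists_avgDiff_le_eLpNorm {μ : Measure X} (hμ : IsDoubling μ) {p : ℝ≥0∞} (hp : 0 < p) :
    ∃ C : ℝ≥0, ∀ (u : X → ℝ) (G : X → ℝ≥0∞) (t : ℝ), 0 < t → AEMeasurable G μ →
      (∀ᵐ x ∂μ, ∀ᵐ y ∂μ, dist y x < t → ‖u x - u y‖ₑ ≤ G x + G y) →
        avgDiff μ p u t ≤ C * eLpNorm G p μ := by
  obtain ⟨D, -, hD⟩ := hμ.exists_measure_ball_two_mul_le
  rcases eq_or_ne p ∞ with rfl | hp'
  · refine ⟨2, fun u G t ht _ h => ?_⟩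
    rw [avgDiff, if_pos rfl, eLpNorm_exponent_top]
    have hG : ∀ᵐ x ∂μ, G x ≤ eLpNormEssSup G μ := by
      filter_upwards [enorm_ae_le_eLpNormEssSup G μ] with x hx using by simpa using hx
    refine essSup_le_of_ae_le _ ?_
    filter_upwards [h, hG] with x hx hGx
    refine essSup_le_of_ae_le _ ((ae_restrict_iff' Metric.isOpen_ball.measurableSet).2 ?_)
    filter_upwards [hx, hG] with y hy hGy hxy
    refine (hy hxy).trans ?_
    rw [ENNReal.coe_ofNat, two_mul]
    exact add_le_add hGx hGy
  · have hr : 0 < p.toReal := ENNReal.toReal_pos hp.ne' hp'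
    set r := p.toReal
    have hC : ((2 : ℝ≥0∞) ^ r * (1 + D)) ^ (1 / r) ≠ ∞ := by finiteness
    refine ⟨(((2 : ℝ≥0∞) ^ r * (1 + D)) ^ (1 / r)).toNNReal, fun u G t ht hGm h => ?_⟩
    rw [ENNReal.coe_toNNReal hC, avgDiff, if_neg hp',
      eLpNorm_eq_lintegral_rpow_enorm_toReal hp.ne' hp',
      ← ENNReal.mul_rpow_of_nonneg _ _ (by positivity)]
    refine ENNReal.rpow_le_rpow ?_ (by positivity)
    simp only [enorm_eq_self]
    have hGr : AEMeasurable (fun x => G x ^ r) μ := hGm.pow_const _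
    calc ∫⁻ x, ⨍⁻ y in Metric.ball x t, ‖u x - u y‖ₑ ^ r ∂μ ∂μ
        ≤ ∫⁻ x, 2 ^ r * (G x ^ r + ⨍⁻ y in Metric.ball x t, G y ^ r ∂μ) ∂μ := by
          refine lintegral_mono_ae ?_
          filter_upwards [h] with x hx
          have h0 := (hμ.ball_pos x t ht).ne'
          have h2 := (hμ.ball_lt_top x t ht).ne
          rw [setLAverage_eq, setLAverage_eq]
          have : ∫⁻ y in Metric.ball x t, ‖u x - u y‖ₑ ^ r ∂μ ≤
              ∫⁻ y in Metric.ball x t, 2 ^ r * (G x ^ r + G y ^ r) ∂μ := by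
            refine setLIntegral_mono_ae' Metric.isOpen_ball.measurableSet ?_
            filter_upwards [hx] with y hy hxy
            exact (ENNReal.rpow_le_rpow (hy hxy) hr.le).trans (ennreal_add_rpow_le hr.le _ _)
          refine (ENNReal.div_le_div_right this _).trans_eq ?_
          rw [lintegral_const_mul' _ _ (by finiteness), lintegral_add_left measurable_const,
            setLIntegral_const, mul_div_assoc, ENNReal.add_div, ENNReal.mul_div_cancel_right h0 h2]
      _ = 2 ^ r * (∫⁻ x, G x ^ r ∂μ + ∫⁻ x, ⨍⁻ y in Metric.ball x t, G y ^ r ∂μ ∂μ) := by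
          rw [lintegral_const_mul' _ _ (by finiteness), lintegral_add_left' hGr]
      _ ≤ 2 ^ r * (∫⁻ x, G x ^ r ∂μ + D * ∫⁻ x, G x ^ r ∂μ) := by
          gcongr
          exact lintegral_setLAverage_ball_le hμ hD ht hGr
      _ = _ := by ring

omit [BorelSpace X] in
/-- Doubling of the scale increases averaged differences up to a constant. -/
theorem exists_avgDiff_le_avgDiff {μ : Measure X} (hμ : IsDoubling μ) {p : ℝ≥0∞} (hp : 0 < p) :
    ∃ C : ℝ≥0, ∀ (u : X → ℝ) (t t' : ℝ), 0 < t → t ≤ t' → t' ≤ 2 * t →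
      avgDiff μ p u t ≤ C * avgDiff μ p u t' := by
  obtain ⟨D, -, hD⟩ := hμ.exists_measure_ball_two_mul_le
  rcases eq_or_ne p ∞ with rfl | hp'
  · refine ⟨1, fun u t t' ht htt _ => ?_⟩
    rw [avgDiff, avgDiff, if_pos rfl, if_pos rfl, ENNReal.coe_one, one_mul]
    refine essSup_mono_ae (ae_of_all _ fun x => ?_)
    exact essSup_mono_measure
      (Measure.restrict_mono (Metric.ball_subset_ball htt) le_rfl).absolutelyContinuous
  · have hr : 0 < p.toReal := ENNReal.toReal_pos hp.ne' hp'
    have hC : (D : ℝ≥0∞) ^ (1 / p.toReal) ≠ ∞ := by finiteness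
    refine ⟨((D : ℝ≥0∞) ^ (1 / p.toReal)).toNNReal, fun u t t' ht htt htt' => ?_⟩
    rw [ENNReal.coe_toNNReal hC, avgDiff, avgDiff, if_neg hp', if_neg hp',
      ← ENNReal.mul_rpow_of_nonneg _ _ (by positivity)]
    refine ENNReal.rpow_le_rpow ?_ (by positivity)
    rw [← lintegral_const_mul' _ _ ENNReal.coe_ne_top]
    refine lintegral_mono fun x => ?_
    exact setLAverage_le_mul_setLAverage (Metric.ball_subset_ball htt)
      (hμ.ball_pos x t ht).ne' (hμ.ball_lt_top x t' (ht.trans_le htt)).ne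
      ((measure_mono (Metric.ball_subset_ball htt')).trans (hD x t ht)) _

end

/-! ### Sequence norms and the passage between continuous and dyadic scales. -/

section

theorem eLpNorm_le_mul_of_forall_enorm_le {α : Type*} [MeasurableSpace α] {μ : Measure α}
    {ε ε' : Type*} [TopologicalSpace ε] [ContinuousENorm ε] [TopologicalSpace ε']
    [ContinuousENorm ε'] {f : α → ε} {g : α → ε'} {c : ℝ≥0∞} (hc : c ≠ ∞) (p : ℝ≥0∞)
    (h : ∀ x, ‖f x‖ₑ ≤ c * ‖g x‖ₑ) : eLpNorm f p μ ≤ c * eLpNorm g p μ := by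
  lift c to ℝ≥0 using hc
  exact eLpNorm_le_mul_eLpNorm_of_ae_le_mul' (ae_of_all _ h) p

theorem ae_lt_top_of_eLpNorm_lt_top {α : Type*} [MeasurableSpace α] {μ : Measure α} {p : ℝ≥0∞}
    (hp : p ≠ 0) {f : α → ℝ≥0∞} (hf : AEMeasurable f μ) (h : eLpNorm f p μ < ∞) :
    ∀ᵐ x ∂μ, f x < ∞ := by
  rcases eq_or_ne p ∞ with rfl | hp'
  · rw [eLpNorm_exponent_top] at h
    filter_upwards [enorm_ae_le_eLpNormEssSup f μ] with x hx
    exact (enorm_eq_self (f x)).symm.trans_le hx |>.trans_lt h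
  · have hr := ENNReal.toReal_pos hp hp'
    have h1 := lintegral_rpow_enorm_lt_top_of_eLpNorm_lt_top hp hp' h
    simp only [enorm_eq_self] at h1
    filter_upwards [ae_lt_top' (hf.pow_const _) h1.ne] with x hx
    exact (ENNReal.rpow_lt_top_iff_of_pos hr).1 hx

theorem eLpNorm_count_eq_ite {ι : Type*} [MeasurableSpace ι] [MeasurableSingletonClass ι]
    {q : ℝ≥0∞} (hq : 0 < q) (a : ι → ℝ≥0∞) :
    eLpNorm a q Measure.count =
      if q = ∞ then ⨆ k, a k else (∑' k, a k ^ q.toReal) ^ (1 / q.toReal) := by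
  split_ifs with h
  · rw [h, eLpNorm_exponent_top, eLpNormEssSup_count]; simp
  · rw [eLpNorm_eq_lintegral_rpow_enorm_toReal hq.ne' h, lintegral_count]; simp

theorem lqLpNorm_eq_eLpNorm_count {X : Type*} [MeasurableSpace X] [MetricSpace X]
    (μ : Measure X) (p : ℝ≥0∞) {q : ℝ≥0∞} (hq : 0 < q) (g : ℤ → X → ℝ) :
    lqLpNorm μ p q g = eLpNorm (fun k => eLpNorm (g k) p μ) q Measure.count := by
  rw [eLpNorm_count_eq_ite hq, lqLpNorm]

theorem eLpNorm_count_comp_equiv {ι : Type*} [MeasurableSpace ι] [MeasurableSingletonClass ι]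
    {q : ℝ≥0∞} (hq : 0 < q) (a : ι → ℝ≥0∞) (e : ι ≃ ι) :
    eLpNorm (fun k => a (e k)) q Measure.count = eLpNorm a q Measure.count := by
  rw [eLpNorm_count_eq_ite hq, eLpNorm_count_eq_ite hq, e.iSup_comp (g := a),
    e.tsum_eq (fun k => a k ^ q.toReal)]

theorem lt_top_of_eLpNorm_count_lt_top {ι : Type*} [MeasurableSpace ι]
    [MeasurableSingletonClass ι] {q : ℝ≥0∞} (hq : 0 < q) {a : ι → ℝ≥0∞}
    (h : eLpNorm a q Measure.count < ∞) (k : ι) : a k < ∞ := by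
  rw [eLpNorm_count_eq_ite hq] at h
  split_ifs at h with hq'
  · exact (le_iSup a k).trans_lt h
  · have hr : 0 < q.toReal := ENNReal.toReal_pos hq.ne' hq'
    rw [ENNReal.rpow_lt_top_iff_of_pos (by positivity)] at h
    exact (ENNReal.rpow_lt_top_iff_of_pos hr).1 ((ENNReal.le_tsum k).trans_lt h)

/-- A discrete Hardy inequality. -/
theorem exists_eLpNorm_count_iSup_pow_mul_le {q : ℝ≥0∞} (hq : 0 < q) {ρ : ℝ≥0∞} (hρ : ρ < 1) :
    ∃ C : ℝ≥0, ∀ a : ℤ → ℝ≥0∞,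
      eLpNorm (fun k => ⨆ i : ℕ, ρ ^ i * a (k + i)) q Measure.count ≤
        C * eLpNorm a q Measure.count := by
  obtain ⟨C, hC⟩ := exists_eLpNorm_iSup_pow_mul_le (Measure.count : Measure ℤ) hq hρ
  -- The `i`-th function is the shift of `a` by `i`; shifts preserve the `ℓ^q` norm.
  refine ⟨C, fun a => (hC (fun i k => a (k + i)) fun i =>
    (measurable_of_countable _).aemeasurable).trans ?_⟩
  gcongr
  exact iSup_le fun i => (eLpNorm_count_comp_equiv hq a (Equiv.addRight (i : ℤ))).le

theorem two_rpow_ne_zero (r : ℝ) : (2 : ℝ≥0∞) ^ r ≠ 0 := by simp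

theorem two_rpow_ne_top (r : ℝ) : (2 : ℝ≥0∞) ^ r ≠ ∞ := by simp

theorem two_rpow_add (a b : ℝ) : (2 : ℝ≥0∞) ^ (a + b) = 2 ^ a * 2 ^ b :=
  ENNReal.rpow_add _ _ two_ne_zero ENNReal.ofNat_ne_top

theorem two_rpow_mul_mul_mul (a c d : ℝ) (b : ℝ≥0∞) :
    (2 : ℝ≥0∞) ^ a * b * 2 ^ c * 2 ^ d = 2 ^ (a + c + d) * b := by
  rw [two_rpow_add, two_rpow_add]; ring

theorem ofReal_two_zpow_rpow (m : ℤ) (r : ℝ) :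
    ENNReal.ofReal (((2 : ℝ) ^ m) ^ r) = 2 ^ (m * r) := by
  rw [← Real.rpow_intCast, ← Real.rpow_mul two_pos.le, ← ENNReal.ofReal_rpow_of_pos two_pos,
    ENNReal.ofReal_ofNat]

theorem lintegral_Ioi_eq_tsum_dyadic (f : ℝ → ℝ≥0∞) :
    ∫⁻ t in Ioi (0 : ℝ), f t = ∑' m : ℤ, ∫⁻ t in Ico ((2 : ℝ) ^ m) (2 ^ (m + 1)), f t := by
  rw [← lintegral_iUnion (fun _ => measurableSet_Ico)]
  · congr 2
    ext t
    refine ⟨fun ht => mem_iUnion.2 (exists_mem_Ico_zpow ht one_lt_two), fun ht => ?_⟩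
    obtain ⟨m, hm⟩ := mem_iUnion.1 ht
    exact lt_of_lt_of_le (by positivity) hm.1
  · exact (zpow_right_mono₀ (one_le_two (α := ℝ))).pairwise_disjoint_on_Ico_succ

theorem volume_Ico_dyadic (m : ℤ) :
    volume (Ico ((2 : ℝ) ^ m) (2 ^ (m + 1))) = (2 : ℝ≥0∞) ^ (m : ℝ) := by
  rw [Real.volume_Ico, zpow_add_one₀ two_ne_zero, mul_two, add_sub_cancel_right]
  simpa using ofReal_two_zpow_rpow m 1

/-- The continuous `L^q(dt / t^{1+sq})` norm used in the definition of the Besov seminorm. -/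
noncomputable def scaleNorm (s : ℝ) (q : ℝ≥0∞) (A : ℝ → ℝ≥0∞) : ℝ≥0∞ :=
  if q = ∞ then ⨆ t ∈ Ioi (0 : ℝ), ENNReal.ofReal (t ^ (-s)) * A t
  else (∫⁻ t in Ioi (0 : ℝ), A t ^ q.toReal / ENNReal.ofReal (t ^ (1 + s * q.toReal))) ^
    (1 / q.toReal)

/-- For finite `q`, the weight on `[2 ^ m, 2 ^ (m + 1))` has mass at most `2 ^ m * 2 ^ (-m (1 + s
q)) = 2 ^ (-m s q)`, which cancels the normalisation of `b m`. Measurability of `A` is not needed.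
-/
theorem scaleNorm_le_eLpNorm_count {s : ℝ} (hs : 0 < s) {q : ℝ≥0∞} (hq : 0 < q)
    {A : ℝ → ℝ≥0∞} {b : ℤ → ℝ≥0∞}
    (h : ∀ (m : ℤ) (t : ℝ), t ∈ Ico ((2 : ℝ) ^ m) (2 ^ (m + 1)) → A t ≤ 2 ^ (m * s) * b m) :
    scaleNorm s q A ≤ eLpNorm b q Measure.count := by
  rw [eLpNorm_count_eq_ite hq, scaleNorm]
  split_ifs with hq'
  · refine iSup₂_le fun t ht => ?_
    obtain ⟨m, hm⟩ := exists_mem_Ico_zpow (mem_Ioi.1 ht) one_lt_two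
    refine le_trans ?_ (le_iSup b m)
    calc ENNReal.ofReal (t ^ (-s)) * A t
        ≤ ENNReal.ofReal (((2 : ℝ) ^ m) ^ (-s)) * (2 ^ (m * s) * b m) := by
          gcongr ?_ * ?_
          · exact ENNReal.ofReal_le_ofReal
              (Real.rpow_le_rpow_of_nonpos (by positivity) hm.1 (by linarith))
          · exact h m t hm
      _ = b m := by
          rw [ofReal_two_zpow_rpow, ← mul_assoc, ← two_rpow_add]
          simp
  · have hr : 0 < q.toReal := ENNReal.toReal_pos hq.ne' hq'
    set r := q.toReal
    refine ENNReal.rpow_le_rpow ?_ (by positivity)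
    rw [lintegral_Ioi_eq_tsum_dyadic]
    refine ENNReal.tsum_le_tsum fun m => ?_
    calc ∫⁻ t in Ico ((2 : ℝ) ^ m) (2 ^ (m + 1)), A t ^ r / ENNReal.ofReal (t ^ (1 + s * r))
        ≤ ∫⁻ t in Ico ((2 : ℝ) ^ m) (2 ^ (m + 1)),
            (2 ^ (m * s) * b m) ^ r / 2 ^ (m * (1 + s * r)) := by
          refine setLIntegral_mono' measurableSet_Ico fun t ht => ?_
          refine ENNReal.div_le_div (ENNReal.rpow_le_rpow (h m t ht) hr.le) ?_
          rw [← ofReal_two_zpow_rpow]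
          exact ENNReal.ofReal_le_ofReal (Real.rpow_le_rpow (by positivity) ht.1 (by positivity))
      _ = b m ^ r := by
          rw [setLIntegral_const, volume_Ico_dyadic, ENNReal.mul_rpow_of_nonneg _ _ hr.le,
            ← ENNReal.rpow_mul, div_eq_mul_inv, ← ENNReal.rpow_neg, two_rpow_mul_mul_mul]
          ring_nf
          simp

theorem exists_eLpNorm_count_le_scaleNorm {s : ℝ} (hs : 0 < s) {q : ℝ≥0∞} (hq : 0 < q) :
    ∃ C : ℝ≥0, ∀ (A : ℝ → ℝ≥0∞) (b : ℤ → ℝ≥0∞),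
      (∀ (m : ℤ) (t : ℝ), t ∈ Ico ((2 : ℝ) ^ m) (2 ^ (m + 1)) → 2 ^ (m * s) * b m ≤ A t) →
        eLpNorm b q Measure.count ≤ C * scaleNorm s q A := by
  rcases eq_or_ne q ∞ with rfl | hq'
  · refine ⟨1, fun A b h => ?_⟩
    rw [eLpNorm_count_eq_ite hq, scaleNorm, if_pos rfl, if_pos rfl, ENNReal.coe_one, one_mul]
    refine iSup_le fun m => ?_
    have hm : (2 : ℝ) ^ m ∈ Ioi (0 : ℝ) := mem_Ioi.2 (by positivity)
    refine le_trans ?_ (le_iSup₂ (f := fun t (_ : t ∈ Ioi (0 : ℝ)) =>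
      ENNReal.ofReal (t ^ (-s)) * A t) _ hm)
    have h1 := h m (2 ^ m) ⟨le_rfl, zpow_lt_zpow_right₀ one_lt_two (by simp)⟩
    calc b m = ENNReal.ofReal (((2 : ℝ) ^ m) ^ (-s)) * (2 ^ (m * s) * b m) := by
          rw [ofReal_two_zpow_rpow, ← mul_assoc, ← two_rpow_add]
          simp
      _ ≤ _ := by gcongr
  · have hr : 0 < q.toReal := ENNReal.toReal_pos hq.ne' hq'
    set r := q.toReal with hr_def
    -- The loss from bounding `t` by the right endpoint `2 ^ (m + 1)` in the weight.
    have hC : ((2 : ℝ≥0∞) ^ (1 + s * r)) ^ (1 / r) ≠ ∞ := by finiteness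
    refine ⟨(((2 : ℝ≥0∞) ^ (1 + s * r)) ^ (1 / r)).toNNReal, fun A b h => ?_⟩
    rw [ENNReal.coe_toNNReal hC, eLpNorm_count_eq_ite hq, scaleNorm, if_neg hq', if_neg hq',
      ← ENNReal.mul_rpow_of_nonneg _ _ (by positivity), ← hr_def]
    refine ENNReal.rpow_le_rpow ?_ (by positivity)
    rw [lintegral_Ioi_eq_tsum_dyadic, ← ENNReal.tsum_mul_left]
    refine ENNReal.tsum_le_tsum fun m => ?_
    calc b m ^ r = 2 ^ (1 + s * r) * ∫⁻ t in Ico ((2 : ℝ) ^ m) (2 ^ (m + 1)),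
            (2 ^ (m * s) * b m) ^ r / 2 ^ (((m + 1 : ℤ) : ℝ) * (1 + s * r)) := by
          rw [setLIntegral_const, volume_Ico_dyadic, ENNReal.mul_rpow_of_nonneg _ _ hr.le,
            ← ENNReal.rpow_mul, div_eq_mul_inv, ← ENNReal.rpow_neg, two_rpow_mul_mul_mul,
            ← mul_assoc, ← two_rpow_add]
          push_cast
          ring_nf
          simp
      _ ≤ _ := by
          refine mul_le_mul' le_rfl ?_
          refine setLIntegral_mono' measurableSet_Ico fun t ht => ?_
          refine ENNReal.div_le_div (ENNReal.rpow_le_rpow (h m t ht) hr.le) ?_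
          rw [← ofReal_two_zpow_rpow]
          have h0 : 0 < t := lt_of_lt_of_le (by positivity) ht.1
          exact ENNReal.ofReal_le_ofReal (Real.rpow_le_rpow h0.le ht.2.le (by positivity))

end

/-! ### From a Hajłasz gradient to the Besov seminorm. -/

section

variable {X : Type*} [MetricSpace X] [MeasurableSpace X] {μ : Measure X}

theorem besovNorm_eq_scaleNorm (μ : Measure X) (s : ℝ) (p q : ℝ≥0∞) (u : X → ℝ) :
    besovNorm μ s p q u = scaleNorm s q (avgDiff μ p u) := rfl

/-- The supremum of all terms of a Hajłasz gradient at scales at most `2 ^ (-j)`. -/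
noncomputable def gradientSup (s : ℝ) (g : ℤ → X → ℝ) (j : ℤ) (x : X) : ℝ≥0∞ :=
  ⨆ i : ℕ, 2 ^ (-((j + i : ℤ) : ℝ) * s) * ‖g (j + i) x‖ₑ

omit [MetricSpace X] in
theorem aemeasurable_gradientSup {g : ℤ → X → ℝ} (hg : ∀ k, AEStronglyMeasurable (g k) μ)
    (s : ℝ) (j : ℤ) : AEMeasurable (gradientSup s g j) μ :=
  AEMeasurable.iSup fun i => (hg (j + i)).enorm.const_mul _

theorem IsHajlaszGradient.ae_enorm_sub_le {s : ℝ} (hs : 0 < s) {u : X → ℝ} {g : ℤ → X → ℝ}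
    (hg : IsHajlaszGradient μ s u g) (j : ℤ) :
    ∃ E : Set X, μ E = 0 ∧ ∀ x ∉ E, ∀ y ∉ E, dist x y < (2 : ℝ) ^ (-j) →
      ‖u x - u y‖ₑ ≤ gradientSup s g j x + gradientSup s g j y := by
  obtain ⟨-, hpos, E, hE, h⟩ := hg
  refine ⟨E, hE, fun x hx y hy hd => ?_⟩
  rcases eq_or_ne x y with rfl | hxy
  · simp
  obtain ⟨n, hn⟩ := exists_mem_Ico_zpow (dist_pos.2 hxy) (one_lt_two (α := ℝ))
  have hnj : n < -j := (zpow_lt_zpow_iff_right₀ (one_lt_two (α := ℝ))).1 (hn.1.trans_lt hd)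
  -- The annulus `[2 ^ n, 2 ^ (n + 1))` carries the gradient index `k = -n - 1`.
  obtain ⟨i, hi⟩ := Int.eq_ofNat_of_zero_le (show 0 ≤ -n - 1 - j by lia)
  have hk : -(j + i : ℤ) = n + 1 := by lia
  have h1 := h (j + i) x y hx hy (by rw [hk, add_sub_cancel_right]; exact hn.1)
    (by rw [hk]; exact hn.2)
  have hterm : ∀ z, 2 ^ (-((j + i : ℤ) : ℝ) * s) * ‖g (j + i) z‖ₑ ≤ gradientSup s g j z :=
    fun z => le_iSup (fun i : ℕ => 2 ^ (-((j + i : ℤ) : ℝ) * s) * ‖g (j + i) z‖ₑ) i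
  refine le_trans ?_ (add_le_add (hterm x) (hterm y))
  rw [← mul_add, ← Int.cast_neg, ← ofReal_two_zpow_rpow, Real.enorm_eq_ofReal (hpos _ _),
    Real.enorm_eq_ofReal (hpos _ _), ← ENNReal.ofReal_add (hpos _ _) (hpos _ _),
    ← ENNReal.ofReal_mul (by positivity), Real.enorm_eq_ofReal_abs]
  refine ENNReal.ofReal_le_ofReal (h1.trans ?_)
  refine mul_le_mul_of_nonneg_right ?_ (add_nonneg (hpos _ _) (hpos _ _))
  refine Real.rpow_le_rpow dist_nonneg ?_ hs.le
  rw [hk]; exact hn.2.le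

theorem two_rpow_neg_lt_one {r : ℝ} (hr : 0 < r) : (2 : ℝ≥0∞) ^ (-r) < 1 :=
  ENNReal.rpow_lt_one_of_one_lt_of_neg ENNReal.one_lt_two (by linarith)

omit [MetricSpace X] in
-- The factor `2 ^ (-i s)` is split into two equal halves: one makes the supremum commute with the
-- `L^p` norm up to a constant, the other stays for the Hardy inequality in `ℓ^q`.
theorem exists_eLpNorm_gradientSup_le (μ : Measure X) {s : ℝ} (hs : 0 < s) {p : ℝ≥0∞}
    (hp : 0 < p) :
    ∃ C : ℝ≥0, ∀ g : ℤ → X → ℝ, (∀ k, AEStronglyMeasurable (g k) μ) → ∀ j : ℤ,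
      eLpNorm (gradientSup s g j) p μ ≤
        C * (2 ^ (-(j : ℝ) * s) * ⨆ i : ℕ, (2 ^ (-(s / 2))) ^ i * eLpNorm (g (j + i)) p μ) := by
  obtain ⟨C, hC⟩ := exists_eLpNorm_iSup_pow_mul_le μ hp (two_rpow_neg_lt_one (half_pos hs))
  refine ⟨C, fun g hg j => ?_⟩
  have hpow : ∀ i : ℕ, ((2 : ℝ≥0∞) ^ (-(s / 2))) ^ i = 2 ^ (-(s / 2) * i) := fun i => by
    rw [ENNReal.rpow_mul, ENNReal.rpow_natCast]
  have hG : gradientSup s g j = fun x => ⨆ i : ℕ, ((2 : ℝ≥0∞) ^ (-(s / 2))) ^ i *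
      (2 ^ (-(j : ℝ) * s) * (2 ^ (-(s / 2))) ^ i * ‖g (j + i) x‖ₑ) := by
    ext x
    refine iSup_congr fun i => ?_
    rw [hpow, ← two_rpow_add, ← mul_assoc, ← two_rpow_add]
    congr 2
    push_cast
    ring
  rw [hG]
  refine (hC _ fun i => (hg (j + i)).enorm.const_mul _).trans ?_
  gcongr
  rw [ENNReal.mul_iSup]
  refine iSup_mono fun i => ?_
  rw [← mul_assoc]
  refine eLpNorm_le_mul_of_forall_enorm_le ?_ p fun x => ?_
  · rw [hpow, ← two_rpow_add]; exact two_rpow_ne_top _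
  · rw [enorm_eq_self]

theorem exists_besovNorm_le_lqLpNorm [BorelSpace X] (hμ : IsDoubling μ) {s : ℝ}
    (hs : 0 < s) {p q : ℝ≥0∞} (hp : 0 < p) (hq : 0 < q) :
    ∃ C : ℝ≥0, ∀ (u : X → ℝ) (g : ℤ → X → ℝ), IsHajlaszGradient μ s u g →
      besovNorm μ s p q u ≤ C * lqLpNorm μ p q g := by
  obtain ⟨C₁, h₁⟩ := exists_avgDiff_le_eLpNorm hμ hp
  obtain ⟨C₂, h₂⟩ := exists_eLpNorm_gradientSup_le μ hs hp
  obtain ⟨C₃, h₃⟩ := exists_eLpNorm_count_iSup_pow_mul_le hq (two_rpow_neg_lt_one (half_pos hs))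
  obtain ⟨c, hc⟩ : ∃ c : ℝ≥0, (c : ℝ≥0∞) = C₁ * C₂ * 2 ^ s :=
    ⟨((C₁ : ℝ≥0∞) * C₂ * 2 ^ s).toNNReal, ENNReal.coe_toNNReal (by finiteness)⟩
  refine ⟨c * C₃, fun u g hg => ?_⟩
  let a : ℤ → ℝ≥0∞ := fun k => eLpNorm (g k) p μ
  let b : ℤ → ℝ≥0∞ := fun k => ⨆ i : ℕ, (2 ^ (-(s / 2))) ^ i * a (k + i)
  rw [besovNorm_eq_scaleNorm, lqLpNorm_eq_eLpNorm_count μ p hq, ENNReal.coe_mul]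
  calc scaleNorm s q (avgDiff μ p u)
      -- The index `j = -1 - m` makes the radius `2 ^ (-j) = 2 ^ (m + 1)` exceed every `t` in the
      -- dyadic interval; the extra power of two is the `2 ^ s` in `c`. The reflection of `ℤ` does
      -- not change the `ℓ^q` norm.
      ≤ eLpNorm (fun m => c * b (Equiv.subLeft (-1 : ℤ) m)) q Measure.count := by
        refine scaleNorm_le_eLpNorm_count hs hq fun m t ht => ?_
        have ht0 : 0 < t := lt_of_lt_of_le (by positivity) ht.1
        obtain ⟨E, hE, hEu⟩ := hg.ae_enorm_sub_le hs (-1 - m)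
        have hae : ∀ᵐ x ∂μ, x ∉ E := measure_eq_zero_iff_ae_notMem.1 hE
        have h := h₁ u (gradientSup s g (-1 - m)) t ht0 (aemeasurable_gradientSup hg.1 s _) (by
          filter_upwards [hae] with x hx
          filter_upwards [hae] with y hy hd
          refine hEu x hx y hy ((dist_comm x y).trans_lt (hd.trans (ht.2.trans_eq ?_)))
          congr 1; ring)
        refine h.trans ((mul_le_mul_right (h₂ g hg.1 (-1 - m)) _).trans_eq ?_)
        have he : (2 : ℝ≥0∞) ^ (-((-1 - m : ℤ) : ℝ) * s) = 2 ^ s * 2 ^ (m * s) := by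
          rw [← two_rpow_add]; congr 1; push_cast; ring
        rw [he, hc]
        simp only [b, a, Equiv.subLeft_apply]
        ring
    _ ≤ c * eLpNorm (fun m => b (Equiv.subLeft (-1 : ℤ) m)) q Measure.count :=
        eLpNorm_le_mul_of_forall_enorm_le ENNReal.coe_ne_top q fun m => by
          simp only [enorm_eq_self, le_refl]
    _ = c * eLpNorm b q Measure.count := by rw [eLpNorm_count_comp_equiv hq]
    _ ≤ _ := by
        rw [mul_assoc]
        gcongr
        exact h₃ a

theorem exists_besovNorm_le_hajlaszBesovNorm [BorelSpace X] (hμ : IsDoubling μ) {s : ℝ}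
    (hs : 0 < s) {p q : ℝ≥0∞} (hp : 0 < p) (hq : 0 < q) :
    ∃ C : ℝ≥0, ∀ u : X → ℝ, besovNorm μ s p q u ≤ C * hajlaszBesovNorm μ s p q u := by
  obtain ⟨C, hC⟩ := exists_besovNorm_le_lqLpNorm hμ hs hp hq
  -- A nonzero constant lets multiplication pass through the infimum even when it is `∞`.
  refine ⟨C + 1, fun u => ?_⟩
  have h0 : ((C + 1 : ℝ≥0) : ℝ≥0∞) ≠ 0 := by simp
  rw [hajlaszBesovNorm, ENNReal.mul_iInf_of_ne h0 ENNReal.coe_ne_top]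
  refine le_iInf fun g => ?_
  rw [ENNReal.mul_iInf_of_ne h0 ENNReal.coe_ne_top]
  refine le_iInf fun hg => (hC u g hg).trans ?_
  gcongr
  exact le_self_add

/-- Fix one good point `y` of the ball, where `G y` is finite; then `|u x| ≤ |u y| + G y + G x` for
almost every `x` in the ball, a constant plus an `L^p` function on a set of finite measure. -/
theorem memLp_ball_of_isHajlaszGradient [BorelSpace X] (hμ : IsDoubling μ) {s : ℝ}
    (hs : 0 < s) {p q : ℝ≥0∞} (hp : 0 < p) (hq : 0 < q) {u : X → ℝ} {g : ℤ → X → ℝ}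
    (hu : AEStronglyMeasurable u μ) (hg : IsHajlaszGradient μ s u g)
    (hgfin : lqLpNorm μ p q g < ∞) (x₀ : X) {R : ℝ} (hR : 0 < R) :
    MemLp u p (μ.restrict (Metric.ball x₀ R)) := by
  obtain ⟨C, hC⟩ := exists_eLpNorm_gradientSup_le μ hs hp
  obtain ⟨C', hC'⟩ :=
    exists_eLpNorm_count_iSup_pow_mul_le hq (two_rpow_neg_lt_one (half_pos hs))
  rw [lqLpNorm_eq_eLpNorm_count μ p hq] at hgfin
  -- The scale `2 ^ (n + 1) > 2R` exceeds the distance between any two points of the ball.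
  obtain ⟨n, hn⟩ := exists_mem_Ico_zpow (show 0 < 2 * R by positivity) (one_lt_two (α := ℝ))
  set G := gradientSup s g (-(n + 1))
  have hGm : AEMeasurable G μ := aemeasurable_gradientSup hg.1 s _
  have hGfin : eLpNorm G p μ < ∞ := by
    refine (hC g hg.1 _).trans_lt ?_
    refine ENNReal.mul_lt_top ENNReal.coe_lt_top
      (ENNReal.mul_lt_top (two_rpow_ne_top _).lt_top ?_)
    exact lt_top_of_eLpNorm_count_lt_top hq
      ((hC' _).trans_lt (ENNReal.mul_lt_top ENNReal.coe_lt_top hgfin)) _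
  have hG : MemLp G p μ := ⟨hGm.aestronglyMeasurable, hGfin⟩
  obtain ⟨E, hE, hEu⟩ := hg.ae_enorm_sub_le hs (-(n + 1))
  have hae : ∀ᵐ x ∂μ, x ∉ E := measure_eq_zero_iff_ae_notMem.1 hE
  have hball : MeasurableSet (Metric.ball x₀ R) := Metric.isOpen_ball.measurableSet
  have : IsFiniteMeasure (μ.restrict (Metric.ball x₀ R)) :=
    ⟨by rw [Measure.restrict_apply_univ]; exact hμ.ball_lt_top x₀ R hR⟩
  have hGtop : ∀ᵐ x ∂μ, G x < ∞ := ae_lt_top_of_eLpNorm_lt_top hp.ne' hGm hGfin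
  obtain ⟨y, hyE, hyG, hyB⟩ : ∃ y, y ∉ E ∧ G y < ∞ ∧ y ∈ Metric.ball x₀ R := by
    have hne : (ae (μ.restrict (Metric.ball x₀ R))).NeBot :=
      ae_neBot.2 fun h => (hμ.ball_pos x₀ R hR).ne' (Measure.restrict_eq_zero.1 h)
    exact ((ae_restrict_of_ae hae).and ((ae_restrict_of_ae hGtop).and
      (ae_restrict_mem hball))).exists
  have hc : ‖u y‖ₑ + G y ≠ ∞ := by finiteness
  have hmem : MemLp (fun x => (‖u y‖ₑ + G y) + G x) p (μ.restrict (Metric.ball x₀ R)) :=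
    (memLp_const_enorm (c := ‖u y‖ₑ + G y) (by rwa [enorm_eq_self])).add (hG.restrict _)
  refine ⟨hu.restrict, (eLpNorm_mono_enorm_ae ?_).trans_lt hmem.2⟩
  filter_upwards [ae_restrict_of_ae hae, ae_restrict_mem hball] with x hx hxB
  rw [enorm_eq_self]
  have hd : dist x y < (2 : ℝ) ^ (-(-(n + 1))) := by
    rw [neg_neg]
    have h1 := dist_triangle_right x y x₀
    have h2 := Metric.mem_ball.1 hxB
    have h3 := Metric.mem_ball.1 hyB
    linarith [hn.2]
  calc ‖u x‖ₑ = ‖u y + (u x - u y)‖ₑ := by congr 1; ring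
    _ ≤ ‖u y‖ₑ + ‖u x - u y‖ₑ := enorm_add_le _ _
    _ ≤ ‖u y‖ₑ + (G x + G y) := by gcongr; exact hEu x hx y hyE hd
    _ = _ := by ring

end

/-! ### From the Besov seminorm to a Hajłasz gradient. -/

section

variable {X : Type*} [MetricSpace X] [MeasurableSpace X] [BorelSpace X] {μ : Measure X}

omit [BorelSpace X] in
-- Average over intermediate points `z ∈ B(x, t)`. This ball lies in both `B(x, 2t)` and `B(y, 2t)`,
-- which lie in `B(x, 4t)`, so enlarging the averages costs `D * D`.
theorem exists_enorm_sub_rpow_le_setLAverage (hμ : IsDoubling μ) {r : ℝ} (hr : 0 < r) :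
    ∃ C : ℝ≥0, ∀ u : X → ℝ, AEStronglyMeasurable u μ → ∀ t : ℝ, 0 < t → ∀ x y, dist x y < t →
      ‖u x - u y‖ₑ ^ r ≤ C * (⨍⁻ z in Metric.ball x (2 * t), ‖u x - u z‖ₑ ^ r ∂μ +
        ⨍⁻ z in Metric.ball y (2 * t), ‖u y - u z‖ₑ ^ r ∂μ) := by
  obtain ⟨D, -, hD⟩ := hμ.exists_measure_ball_two_mul_le
  have h2r : (2 : ℝ≥0∞) ^ r ≠ ∞ := two_rpow_ne_top r
  refine ⟨((2 : ℝ≥0∞) ^ r).toNNReal * (D * D), fun u hu t ht x y hd => ?_⟩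
  have h2t : 0 < 2 * t := by positivity
  have h0 := (hμ.ball_pos x t ht).ne'
  have htop := (hμ.ball_lt_top x t ht).ne
  have h4 : μ (Metric.ball x (2 * (2 * t))) ≤ (D * D : ℝ≥0) * μ (Metric.ball x t) := by
    rw [ENNReal.coe_mul, mul_assoc]
    exact (hD x _ h2t).trans (by gcongr; exact hD x t ht)
  have hx : Metric.ball x (2 * t) ⊆ Metric.ball x (2 * (2 * t)) :=
    Metric.ball_subset_ball (by linarith)
  have hy : Metric.ball y (2 * t) ⊆ Metric.ball x (2 * (2 * t)) :=
    Metric.ball_subset_ball' (by rw [dist_comm]; linarith)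
  have hxt : Metric.ball x t ⊆ Metric.ball x (2 * t) := Metric.ball_subset_ball (by linarith)
  have hyt : Metric.ball x t ⊆ Metric.ball y (2 * t) := Metric.ball_subset_ball' (by linarith)
  have hm : AEMeasurable (fun z => ‖u x - u z‖ₑ ^ r) (μ.restrict (Metric.ball x t)) :=
    ((aestronglyMeasurable_const.sub hu.restrict).enorm).pow_const _
  calc ‖u x - u y‖ₑ ^ r = ⨍⁻ _ in Metric.ball x t, ‖u x - u y‖ₑ ^ r ∂μ :=
        (setLAverage_const h0 htop _).symm
    _ ≤ ⨍⁻ z in Metric.ball x t, 2 ^ r * (‖u x - u z‖ₑ ^ r + ‖u y - u z‖ₑ ^ r) ∂μ := by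
        rw [setLAverage_eq, setLAverage_eq]
        gcongr with z
        refine (ENNReal.rpow_le_rpow ?_ hr.le).trans (ennreal_add_rpow_le hr.le _ _)
        calc ‖u x - u y‖ₑ = ‖(u x - u z) - (u y - u z)‖ₑ := by congr 1; ring
          _ ≤ _ := enorm_sub_le
    _ = 2 ^ r * (⨍⁻ z in Metric.ball x t, ‖u x - u z‖ₑ ^ r ∂μ +
          ⨍⁻ z in Metric.ball x t, ‖u y - u z‖ₑ ^ r ∂μ) := by
        rw [setLAverage_eq, setLAverage_eq, setLAverage_eq, lintegral_const_mul' _ _ h2r,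
          lintegral_add_left' hm, mul_div_assoc, ENNReal.add_div]
    _ ≤ 2 ^ r * ((D * D : ℝ≥0) * ⨍⁻ z in Metric.ball x (2 * t), ‖u x - u z‖ₑ ^ r ∂μ +
          (D * D : ℝ≥0) * ⨍⁻ z in Metric.ball y (2 * t), ‖u y - u z‖ₑ ^ r ∂μ) := by
        gcongr
        · exact setLAverage_le_mul_setLAverage hxt h0 (hμ.ball_lt_top _ _ h2t).ne
            ((measure_mono hx).trans h4) _
        · exact setLAverage_le_mul_setLAverage hyt h0 (hμ.ball_lt_top _ _ h2t).ne
            ((measure_mono hy).trans h4) _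
    _ = _ := by
        rw [ENNReal.coe_mul (((2 : ℝ≥0∞) ^ r).toNNReal), ENNReal.coe_toNNReal h2r, ← mul_add,
          mul_assoc]

/-- For finite `p`, `H` is a multiple of the `p`-mean of `|u x - u z|` over `B(x, 2t)`, whose `L^p`
norm is the averaged difference itself. For `p = ∞` a constant `H` suffices. -/
theorem exists_pointwise_bound_of_avgDiff_lt_top (hμ : IsDoubling μ) {p : ℝ≥0∞} (hp : 0 < p) :
    ∃ C : ℝ≥0, ∀ u : X → ℝ, AEStronglyMeasurable u μ → ∀ t : ℝ, 0 < t →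
      avgDiff μ p u (2 * t) < ∞ → ∃ H : X → ℝ≥0∞, AEMeasurable H μ ∧ (∀ᵐ x ∂μ, H x < ∞) ∧
        eLpNorm H p μ ≤ C * avgDiff μ p u (2 * t) ∧
        ∃ E : Set X, μ E = 0 ∧ ∀ x ∉ E, ∀ y ∉ E, dist x y < t → ‖u x - u y‖ₑ ≤ H x + H y := by
  have := hμ.sigmaFinite
  have := hμ.secondCountableTopology
  rcases eq_or_ne p ∞ with rfl | hp'
  · refine ⟨1, fun u hu t ht hA => ⟨fun _ => avgDiff μ ∞ u (2 * t), aemeasurable_const,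
      ae_of_all _ fun _ => hA, ?_, ?_⟩⟩
    · rw [ENNReal.coe_one, one_mul, eLpNorm_exponent_top]
      exact essSup_le_of_ae_le _ (ae_of_all _ fun _ => by simp)
    · set A := avgDiff μ ∞ u (2 * t) with hA_def
      rw [avgDiff, if_pos rfl] at hA_def
      refine ⟨_, ae_iff.1 (ENNReal.ae_le_essSup (μ := μ) fun x =>
        essSup (fun y => ‖u x - u y‖ₑ) (μ.restrict (Metric.ball x (2 * t)))),
        fun x hx y hy hd => ?_⟩
      rw [mem_ofPred_eq, not_not, ← hA_def] at hx hy
      have hsub : ∀ w, dist x w < t → ∀ᵐ z ∂μ.restrict (Metric.ball x t),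
          ‖u w - u z‖ₑ ≤ essSup (fun y => ‖u w - u y‖ₑ) (μ.restrict (Metric.ball w (2 * t))) :=
        fun w hw => ae_restrict_of_ae_restrict_of_subset
          (Metric.ball_subset_ball' (by linarith)) (ENNReal.ae_le_essSup _)
      have hne : (ae (μ.restrict (Metric.ball x t))).NeBot :=
        ae_neBot.2 fun h => (hμ.ball_pos x t ht).ne' (Measure.restrict_eq_zero.1 h)
      -- Both bounds hold for almost every `z ∈ B(x, t)`, a ball of positive measure.
      obtain ⟨z, hz1, hz2⟩ := ((hsub x (by rwa [dist_self])).and (hsub y hd)).exists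
      calc ‖u x - u y‖ₑ = ‖(u x - u z) - (u y - u z)‖ₑ := by congr 1; ring
        _ ≤ ‖u x - u z‖ₑ + ‖u y - u z‖ₑ := enorm_sub_le
        _ ≤ A + A := add_le_add (hz1.trans hx) (hz2.trans hy)
  · have hr : 0 < p.toReal := ENNReal.toReal_pos hp.ne' hp'
    obtain ⟨K, hK⟩ := exists_enorm_sub_rpow_le_setLAverage hμ hr
    set r := p.toReal with hr_def
    -- The factor `2 ^ (1 / r)` comes from splitting the `1 / r`-th power of a sum.
    obtain ⟨C, hC⟩ : ∃ C : ℝ≥0, (C : ℝ≥0∞) = (K : ℝ≥0∞) ^ (1 / r) * 2 ^ (1 / r) :=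
      ⟨((K : ℝ≥0∞) ^ (1 / r) * 2 ^ (1 / r)).toNNReal, ENNReal.coe_toNNReal (by finiteness)⟩
    refine ⟨C, fun u hu t ht hA => ?_⟩
    let h : X → ℝ≥0∞ := fun x => ⨍⁻ z in Metric.ball x (2 * t), ‖u x - u z‖ₑ ^ r ∂μ
    have hm : AEMeasurable h μ := by
      have hF : AEMeasurable (Function.uncurry fun x z => ‖u x - u z‖ₑ ^ r) (μ.prod μ) :=
        ((hu.comp_fst.sub hu.comp_snd).enorm).pow_const _
      simp only [h, setLAverage_eq]
      exact (aemeasurable_setLIntegral_ball μ (2 * t) hF).div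
        (measurable_measure_ball μ (2 * t)).aemeasurable
    have hHm : AEMeasurable (fun x => C * h x ^ (1 / r)) μ := (hm.pow_const _).const_mul _
    have hnorm : eLpNorm (fun x => C * h x ^ (1 / r)) p μ ≤ C * avgDiff μ p u (2 * t) := by
      refine (eLpNorm_le_mul_of_forall_enorm_le (g := fun x => h x ^ (1 / r)) (c := C) ENNReal.coe_ne_top
        p fun x => by simp only [enorm_eq_self, le_refl]).trans_eq ?_
      rw [eLpNorm_eq_lintegral_rpow_enorm_toReal hp.ne' hp', avgDiff, if_neg hp']
      simp only [enorm_eq_self, ← hr_def, ← ENNReal.rpow_mul, one_div_mul_cancel hr.ne',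
        ENNReal.rpow_one, h]
    refine ⟨fun x => C * h x ^ (1 / r), hHm, ae_lt_top_of_eLpNorm_lt_top hp.ne' hHm
      (hnorm.trans_lt (ENNReal.mul_lt_top ENNReal.coe_lt_top hA)), hnorm, ∅, measure_empty,
      fun x _ y _ hd => ?_⟩
    have h1 := ENNReal.rpow_le_rpow (hK u hu t ht x y hd) (one_div_pos.2 hr).le
    rw [← ENNReal.rpow_mul, mul_one_div_cancel hr.ne', ENNReal.rpow_one,
      ENNReal.mul_rpow_of_nonneg _ _ (by positivity)] at h1
    refine h1.trans ?_
    rw [← mul_add, hC, mul_assoc]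
    gcongr
    exact ennreal_add_rpow_le (by positivity) _ _

/-- Take the pointwise bound at `t = 2 ^ (-k)` and multiply it by `2 ^ ((k + 1) s)`: on the `k`-th
annulus `d(x, y) ≥ 2 ^ (-k - 1)`, so `d(x, y) ^ s` times this weight is at least `1`. -/
theorem exists_hajlaszGradient_eLpNorm_le (hμ : IsDoubling μ) {s : ℝ} (hs : 0 < s) {p : ℝ≥0∞}
    (hp : 0 < p) :
    ∃ C : ℝ≥0, ∀ u : X → ℝ, AEStronglyMeasurable u μ →
      (∀ m : ℤ, avgDiff μ p u ((2 : ℝ) ^ m) < ∞) →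
        ∃ g : ℤ → X → ℝ, IsHajlaszGradient μ s u g ∧
          ∀ k, eLpNorm (g k) p μ ≤
            C * (2 ^ (-((1 - k : ℤ) : ℝ) * s) * avgDiff μ p u ((2 : ℝ) ^ (1 - k))) := by
  obtain ⟨K, hK⟩ := exists_pointwise_bound_of_avgDiff_lt_top hμ hp
  obtain ⟨C, hC⟩ : ∃ C : ℝ≥0, (C : ℝ≥0∞) = 2 ^ (2 * s) * K :=
    ⟨((2 : ℝ≥0∞) ^ (2 * s) * K).toNNReal, ENNReal.coe_toNNReal (by finiteness)⟩
  refine ⟨C, fun u hu hA => ?_⟩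
  have hpow : ∀ k : ℤ, 2 * (2 : ℝ) ^ (-k) = 2 ^ (1 - k) := fun k => by
    rw [sub_eq_add_neg, zpow_add₀ two_ne_zero, zpow_one]
  choose H hHm hHfin hHnorm E hE hEu using fun k : ℤ =>
    hK u hu ((2 : ℝ) ^ (-k)) (by positivity) (by rw [hpow]; exact hA _)
  have hw : ∀ k : ℤ, (2 : ℝ≥0∞) ^ (((k + 1 : ℤ) : ℝ) * s) ≠ ∞ := fun k => two_rpow_ne_top _
  refine ⟨fun k x => (2 ^ (((k + 1 : ℤ) : ℝ) * s) * H k x).toReal,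
    ⟨fun k => ((hHm k).const_mul _).ennreal_toReal.aestronglyMeasurable,
      fun _ _ => ENNReal.toReal_nonneg,
      -- Points where some `H k` is infinite are discarded, since `toReal` would send the value to
      -- `0`.
      (⋃ k, E k) ∪ ⋃ k, {x | ¬ H k x < ∞}, ?_, fun k x y hx hy hd hd' => ?_⟩, fun k => ?_⟩
  · exact measure_union_null (measure_iUnion_null hE)
      (measure_iUnion_null fun k => ae_iff.1 (hHfin k))
  · simp only [mem_union, mem_iUnion, mem_ofPred_eq, not_or, not_exists, not_not] at hx hy
    have hb := hEu k x (hx.1 k) y (hy.1 k) hd'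
    have hx' := ENNReal.mul_ne_top (hw k) (hx.2 k).ne
    have hy' := ENNReal.mul_ne_top (hw k) (hy.2 k).ne
    rw [← ENNReal.toReal_add hx' hy', ← mul_add, ← Real.norm_eq_abs, ← toReal_enorm,
      ← ENNReal.toReal_ofReal (Real.rpow_nonneg (dist_nonneg (x := x) (y := y)) s),
      ← ENNReal.toReal_mul]
    refine ENNReal.toReal_mono ?_ (hb.trans ?_)
    · rw [mul_add]
      exact ENNReal.mul_ne_top ENNReal.ofReal_ne_top (ENNReal.add_ne_top.2 ⟨hx', hy'⟩)
    · rw [← mul_assoc]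
      refine le_mul_of_one_le_left' ?_
      calc (1 : ℝ≥0∞) = 2 ^ (((-k - 1 : ℤ) : ℝ) * s) * 2 ^ (((k + 1 : ℤ) : ℝ) * s) := by
            rw [← two_rpow_add]; push_cast; ring_nf; simp
        _ ≤ _ := by
            rw [← ofReal_two_zpow_rpow (-k - 1)]
            gcongr
  · calc eLpNorm (fun x => (2 ^ (((k + 1 : ℤ) : ℝ) * s) * H k x).toReal) p μ
        ≤ 2 ^ (((k + 1 : ℤ) : ℝ) * s) * eLpNorm (H k) p μ :=
          eLpNorm_le_mul_of_forall_enorm_le (hw k) p fun x => by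
            rw [Real.enorm_eq_ofReal ENNReal.toReal_nonneg, enorm_eq_self]
            exact ENNReal.ofReal_toReal_le
      _ ≤ 2 ^ (((k + 1 : ℤ) : ℝ) * s) * (K * avgDiff μ p u ((2 : ℝ) ^ (1 - k))) := by
          gcongr
          rw [← hpow]
          exact hHnorm k
      _ = _ := by
          have he : (2 : ℝ≥0∞) ^ (((k + 1 : ℤ) : ℝ) * s) =
              2 ^ (2 * s) * 2 ^ (-((1 - k : ℤ) : ℝ) * s) := by
            rw [← two_rpow_add]; congr 1; push_cast; ring
          rw [he, hC]
          ring

theorem exists_hajlaszBesovNorm_le_besovNorm (hμ : IsDoubling μ) {s : ℝ} (hs : 0 < s)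
    {p q : ℝ≥0∞} (hp : 0 < p) (hq : 0 < q) :
    ∃ C : ℝ≥0, ∀ u : X → ℝ, AEStronglyMeasurable u μ → besovNorm μ s p q u < ∞ →
      hajlaszBesovNorm μ s p q u ≤ C * besovNorm μ s p q u := by
  obtain ⟨C₁, h₁⟩ := exists_avgDiff_le_avgDiff hμ hp
  obtain ⟨C₂, h₂⟩ := exists_eLpNorm_count_le_scaleNorm hs hq
  obtain ⟨C₃, h₃⟩ := exists_hajlaszGradient_eLpNorm_le hμ hs hp
  refine ⟨C₃ * ((C₁ + 1) * C₂), fun u hu hfin => ?_⟩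
  let a : ℤ → ℝ≥0∞ := fun m => 2 ^ (-(m : ℝ) * s) * avgDiff μ p u ((2 : ℝ) ^ m)
  have hD0 : ((C₁ + 1 : ℝ≥0) : ℝ≥0∞) ≠ 0 := by simp
  have ha : eLpNorm a q Measure.count ≤ (C₁ + 1 : ℝ≥0) * (C₂ * besovNorm μ s p q u) := by
    -- Dividing by `C₁ + 1`, which is never zero, gives a sequence lying below `avgDiff` throughout
    -- each dyadic interval, because averaged differences are almost increasing in the scale.
    refine (eLpNorm_le_mul_of_forall_enorm_le
      (g := fun m => ((C₁ + 1 : ℝ≥0) : ℝ≥0∞)⁻¹ * a m) (c := (C₁ + 1 : ℝ≥0)) ENNReal.coe_ne_top q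
      fun m => ?_).trans ?_
    · rw [enorm_eq_self, enorm_eq_self, ← mul_assoc,
        ENNReal.mul_inv_cancel hD0 ENNReal.coe_ne_top, one_mul]
    · gcongr
      refine h₂ _ _ fun m t ht => ?_
      have hle : avgDiff μ p u ((2 : ℝ) ^ m) ≤ (C₁ + 1 : ℝ≥0) * avgDiff μ p u t := by
        refine (h₁ u _ t (by positivity) ht.1 ?_).trans (by gcongr; exact le_self_add)
        rw [mul_comm, ← zpow_add_one₀ two_ne_zero]
        exact ht.2.le
      have hone : (2 : ℝ≥0∞) ^ (m * s) * 2 ^ (-(m : ℝ) * s) = 1 := by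
        rw [← two_rpow_add]; ring_nf; simp
      calc 2 ^ (m * s) * (((C₁ + 1 : ℝ≥0) : ℝ≥0∞)⁻¹ * a m)
          = 2 ^ (m * s) * 2 ^ (-(m : ℝ) * s) *
              (((C₁ + 1 : ℝ≥0) : ℝ≥0∞)⁻¹ * avgDiff μ p u ((2 : ℝ) ^ m)) := by
            simp only [a]; ring
        _ ≤ avgDiff μ p u t := by
            rw [hone, one_mul, mul_comm, ← div_eq_mul_inv]
            exact ENNReal.div_le_of_le_mul' hle
  -- A finite `ℓ^q` norm forces every term to be finite, and the weights are nonzero.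
  have hA : ∀ m : ℤ, avgDiff μ p u ((2 : ℝ) ^ m) < ∞ := fun m => by
    have h := lt_top_of_eLpNorm_count_lt_top hq (ha.trans_lt (by finiteness)) m
    by_contra hcon
    rw [not_lt, top_le_iff] at hcon
    simp only [a, hcon, ENNReal.mul_top (two_rpow_ne_zero _), lt_self_iff_false] at h
  obtain ⟨g, hg, hgnorm⟩ := h₃ u hu hA
  calc hajlaszBesovNorm μ s p q u ≤ lqLpNorm μ p q g := iInf₂_le g hg
    _ = eLpNorm (fun k => eLpNorm (g k) p μ) q Measure.count :=
        lqLpNorm_eq_eLpNorm_count μ p hq g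
    _ ≤ C₃ * eLpNorm (fun k => a (Equiv.subLeft (1 : ℤ) k)) q Measure.count :=
        eLpNorm_le_mul_of_forall_enorm_le ENNReal.coe_ne_top q fun k => by
          rw [enorm_eq_self, enorm_eq_self]; exact hgnorm k
    _ = C₃ * eLpNorm a q Measure.count := by rw [eLpNorm_count_comp_equiv hq]
    _ ≤ C₃ * ((C₁ + 1 : ℝ≥0) * (C₂ * besovNorm μ s p q u)) := by gcongr
    _ = _ := by rw [ENNReal.coe_mul C₃, ENNReal.coe_mul _ C₂]; ring

omit [BorelSpace X] in
theorem aestronglyMeasurable_of_forall_ball {u : X → ℝ}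
    (hu : ∀ (x : X) (r : ℝ), 0 < r → AEStronglyMeasurable u (μ.restrict (Metric.ball x r))) :
    AEStronglyMeasurable u μ := by
  rcases isEmpty_or_nonempty X with hX | ⟨⟨x₀⟩⟩
  · rw [Measure.eq_zero_of_isEmpty μ]; exact aestronglyMeasurable_zero_measure u
  · have hU : ⋃ n : ℕ, Metric.ball x₀ ((n : ℝ) + 1) = univ := by
      refine eq_univ_of_forall fun x => mem_iUnion.2 ?_
      obtain ⟨n, hn⟩ := exists_nat_gt (dist x x₀)
      exact ⟨n, by rw [Metric.mem_ball]; linarith⟩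
    rw [← Measure.restrict_univ (μ := μ), ← hU, aestronglyMeasurable_iUnion_iff]
    exact fun n => hu x₀ _ (by positivity)

theorem hajlaszBesovSpace_eq_besovSpace (hμ : IsDoubling μ) {s : ℝ} (hs : 0 < s)
    {p q : ℝ≥0∞} (hp : 0 < p) (hq : 0 < q) :
    hajlaszBesovSpace μ s p q = besovSpace μ s p q := by
  obtain ⟨C, hC⟩ := exists_besovNorm_le_hajlaszBesovNorm hμ hs hp hq
  obtain ⟨C', hC'⟩ := exists_hajlaszBesovNorm_le_besovNorm hμ hs hp hq
  ext u
  constructor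
  · rintro ⟨hu, hfin⟩
    obtain ⟨g, hg⟩ := iInf_lt_iff.1 hfin
    obtain ⟨hgrad, hgfin⟩ := iInf_lt_iff.1 hg
    exact ⟨fun x r hr => memLp_ball_of_isHajlaszGradient hμ hs hp hq hu hgrad hgfin x hr,
      (hC u).trans_lt (ENNReal.mul_lt_top ENNReal.coe_lt_top hfin)⟩
  · rintro ⟨hu, hfin⟩
    have hum := aestronglyMeasurable_of_forall_ball fun x r hr => (hu x r hr).1
    exact ⟨hum, (hC' u hum hfin).trans_lt (ENNReal.mul_lt_top ENNReal.coe_lt_top hfin)⟩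

end

end MetricBesov

theorem theorem1p2 {X : Type*} [MetricSpace X] [MeasurableSpace X] [BorelSpace X]
    (μ : Measure X) (hμ : MetricBesov.IsDoubling μ)
    (s : ℝ) (hs : 0 < s) (p q : ℝ≥0∞) (hp : 0 < p) (hq : 0 < q) :
    MetricBesov.hajlaszBesovSpace μ s p q = MetricBesov.besovSpace μ s p q ∧
      ∃ C : ℝ≥0, ∀ u ∈ MetricBesov.hajlaszBesovSpace μ s p q,
        MetricBesov.besovNorm μ s p q u ≤ C * MetricBesov.hajlaszBesovNorm μ s p q u ∧
          MetricBesov.hajlaszBesovNorm μ s p q u ≤ C * MetricBesov.besovNorm μ s p q u := by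
  have heq := MetricBesov.hajlaszBesovSpace_eq_besovSpace hμ hs hp hq
  obtain ⟨C, hC⟩ := MetricBesov.exists_besovNorm_le_hajlaszBesovNorm hμ hs hp hq
  obtain ⟨C', hC'⟩ := MetricBesov.exists_hajlaszBesovNorm_le_besovNorm hμ hs hp hq
  refine ⟨heq, max C C', fun u hu => ⟨(hC u).trans ?_, (hC' u hu.1 (heq ▸ hu).2).trans ?_⟩⟩
  · gcongr; exact le_max_left _ _
  · gcongr; exact le_max_right _ _
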